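/- Consider a sequence, indexed by $n\ge 1$, of multiclass multi-pool networks with finite sets of customer classes $\mathcal I=\{1,\dots,I\}$ and server pools $\mathcal J=\{1,\dots,J\}$. Let $\mathcal E\subset\mathcal I\times\mathcal J$ be the set of pairs $(i,j)$ such that pool $j$ can serve class $i$; write $i\sim j$ for $(i,j)\in\mathcal E$ and $\mathcal J(i)=\{j: i\sim j\}$, and assume that the bipartite graph $(\mathcal I\cup\mathcal J,\mathcal E)$ is a tree. The $n$-th system has arrival rates $\lambda_i^n>0$, service rates $\mu_{ij}^n>0$ for $i\sim j$, and positive integer numbers of servers $N_j^n$. Assume (Halfin--Whitt regime) that, as $n\to\infty$, $\lambda_i^n/n\to\lambda_i>0$, $N_j^n/n\to\nu_j>0$, $\mu_{ij}^n\to\mu_{ij}>0$, $(\lambda_i^n-n\lambda_i)/\sqrt n\to\hat\lambda_i$, $\sqrt n(\mu_{ij}^n-\mu_{ij})\to\hat\mu_{ij}$ and $\sqrt n(n^{-1}N_j^n-\nu_j)\to\hat\nu_j$ (with real limits). Assume also complete resource pooling: the problem of minimizing $\max_j\sum_i\xi_{ij}$ over nonnegative $\xi\in\mathbb R^{I\times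 J}$ with $\xi_{ij}=0$ for $i\nsim j$ and $\sum_j\mu_{ij}\nu_j\xi_{ij}=\lambda_i$ for all $i$ has a unique solution $\xi^*$, which satisfies $\sum_i\xi^*_{ij}=1$ for all $j$ and $\xi^*_{ij}>0$ for $i\sim j$. Let $e$ denote the all-ones vector, $\Delta_I$ and $\Delta_J$ the sets of probability vectors in $\mathbb R^I$ and $\mathbb R^J$, and $a^\pm=\max(\pm a,0)$. For $\alpha\in\mathbb R^I$, $\beta\in\mathbb R^J$ with $\langle e,\alpha\rangle=\langle e,\beta\rangle$ let $\Psi(\alpha,\beta)\in\mathbb R^{I\times J}$ be the unique array with $\Psi_{ij}=0$ for $i\nsim j$, row sums $\sum_j\Psi_{ij}=\alpha_i$ and column sums $\sum_i\Psi_{ij}=\beta_j$. The limiting controlled diffusion has the drift $$b_i(x,u)=h_i-\sum_{j\in\mathcal J(i)}\mu_{ij}\Psi_{ij}\bigl(x-\langle e,x\rangle^+u^c,\,-\langle e,x\rangle^-u^s\bigr),\qquad x\in\mathbb R^I,\ u=(u^c,u^s)\in\Delta_I\times\Delta_J,$$ where $h_i=\hat\lambda_i-\sum_{j\in\mathcal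 J(i)}(\mu_{ij}\xi^*_{ij}\hat\nu_j+\hat\mu_{ij}\xi^*_{ij}\nu_j)$. Fix any pool $\hat\jmath\in\mathcal J$. (1) There are matrices $B_1\in\mathbb R^{I\times I}$, $B_2\in\mathbb R^{I\times J}$ such that the $\hat\jmath$-th column of $B_2$ is zero and $$b(x,u)=h-B_1\bigl(x-\langle e,x\rangle^+u^c\bigr)+\langle e,x\rangle^-B_2u^s\qquad\text{for all }x\in\mathbb R^I,\ u\in\Delta_I\times\Delta_J.$$ For any such $B_1,B_2$, the matrix $B_1$ is invertible and $$\inf_{u^s\in\Delta_J}\bigl(1+\langle e,B_1^{-1}B_2u^s\rangle\bigr)>0.$$ (2) For every $n\ge1$ there are matrices $B_1^n\in\mathbb R^{I\times I}$, $B_2^n\in\mathbb R^{I\times J}$ such that the $\hat\jmath$-th column of $B_2^n$ is zero and $$\sum_{j\in\mathcal J(i)}\mu^n_{ij}\Psi_{ij}(\alpha,\beta)=(B_1^n\alpha+B_2^n\beta)_i\qquad\text{for all }i\in\mathcal I\text{ and all }(\alpha,\beta)\text{ with }\langle e,\alpha\rangle=\langle e,\beta\rangle.$$ For any such $B_1^n,B_2^n$,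 the matrix $B_1^n$ is invertible and $$\inf_{u^s\in\Delta_J}\bigl(1+\langle e,(B_1^n)^{-1}B_2^nu^s\rangle\bigr)>0.$$ -/

import Mathlib

open Filter Topology Matrix

namespace PSN

variable {I J : Type*} [Fintype I] [Fintype J] [DecidableEq I] [DecidableEq J]

/-- The bipartite graph on classes `I` and server pools `J` with edge set `E ⊆ I × J`. -/
def bipartiteGraph (E : Finset (I × J)) : SimpleGraph (I ⊕ J) where
  Adj v w := (∃ i j, v = Sum.inl i ∧ w = Sum.inr j ∧ (i, j) ∈ E) ∨
    (∃ i j, v = Sum.inr j ∧ w = Sum.inl i ∧ (i, j) ∈ E)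
  symm := ⟨by
    rintro v w (⟨i, j, hv, hw, h⟩ | ⟨i, j, hv, hw, h⟩)
    · exact Or.inr ⟨i, j, hw, hv, h⟩
    · exact Or.inl ⟨i, j, hw, hv, h⟩⟩
  loopless := ⟨by
    rintro v (⟨i, j, hv, hw, -⟩ | ⟨i, j, hv, hw, -⟩) <;> simp [hv] at hw⟩

/-- `𝒥(i)`: the pools that can serve class `i`. -/
def pools (E : Finset (I × J)) (i : I) : Finset J := {j | (i, j) ∈ E}

/-- `ℝ^𝒢`: the real `I × J` arrays that vanish off the edges. -/
def supportedOn (E : Finset (I × J)) : Set (I → J → ℝ) :=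
  {ξ | ∀ i j, (i, j) ∉ E → ξ i j = 0}

/-- Feasibility for the linear program `minimize max_j ∑ i, ξ i j` over `ξ ∈ ℝ^𝒢₊`
subject to `∑ j, μ i j * ν j * ξ i j = lam i`. -/
def LPFeasible (E : Finset (I × J)) (lam : I → ℝ) (ν : J → ℝ) (μ : I → J → ℝ)
    (ξ : I → J → ℝ) : Prop :=
  ξ ∈ supportedOn E ∧ (∀ i j, 0 ≤ ξ i j) ∧
    ∀ i, ∑ j ∈ pools E i, μ i j * ν j * ξ i j = lam i

/-- Optimality for that linear program. -/
def LPOptimal (E : Finset (I × J)) (lam : I → ℝ) (ν : J → ℝ) (μ : I → J → ℝ)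
    (ξ : I → J → ℝ) : Prop :=
  LPFeasible E lam ν μ ξ ∧
    ∀ ξ', LPFeasible E lam ν μ ξ' → (⨆ j, ∑ i, ξ i j) ≤ ⨆ j, ∑ i, ξ' i j

/-- A sequence of multiclass multi-pool networks, indexed by `n ≥ 1`, in the Halfin--Whitt
regime, on a tree, under complete resource pooling. Service rates off the edges are
irrelevant. -/
structure Network (I J : Type*) [Fintype I] [Fintype J] [DecidableEq I] [DecidableEq J] where
  /-- the edges of the graph -/
  E : Finset (I × J)
  isTree : (bipartiteGraph E).IsTree
  /-- arrival rates, service rates and numbers of servers of the `n`-th system -/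
  lamN : ℕ → I → ℝ
  μN : ℕ → I → J → ℝ
  serversN : ℕ → J → ℕ
  lamN_pos : ∀ n, 1 ≤ n → ∀ i, 0 < lamN n i
  μN_pos : ∀ n, 1 ≤ n → ∀ i j, (i, j) ∈ E → 0 < μN n i j
  serversN_pos : ∀ n, 1 ≤ n → ∀ j, 0 < serversN n j
  /-- first-order limits -/
  lam : I → ℝ
  μ : I → J → ℝ
  ν : J → ℝ
  lam_pos : ∀ i, 0 < lam i
  μ_pos : ∀ i j, (i, j) ∈ E → 0 < μ i j
  ν_pos : ∀ j, 0 < ν j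
  tendsto_lam : ∀ i, Tendsto (fun n : ℕ => lamN n i / n) atTop (𝓝 (lam i))
  tendsto_ν : ∀ j, Tendsto (fun n : ℕ => (serversN n j : ℝ) / n) atTop (𝓝 (ν j))
  tendsto_μ : ∀ i j, (i, j) ∈ E → Tendsto (fun n : ℕ => μN n i j) atTop (𝓝 (μ i j))
  /-- second-order limits -/
  lamHat : I → ℝ
  μHat : I → J → ℝ
  νHat : J → ℝ
  tendsto_lamHat : ∀ i,
    Tendsto (fun n : ℕ => (lamN n i - n * lam i) / Real.sqrt n) atTop (𝓝 (lamHat i))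
  tendsto_μHat : ∀ i j, (i, j) ∈ E →
    Tendsto (fun n : ℕ => Real.sqrt n * (μN n i j - μ i j)) atTop (𝓝 (μHat i j))
  tendsto_νHat : ∀ j,
    Tendsto (fun n : ℕ => Real.sqrt n * ((serversN n j : ℝ) / n - ν j)) atTop (𝓝 (νHat j))
  /-- complete resource pooling: the linear program has the unique solution `ξ`, ... -/
  ξ : I → J → ℝ
  ξ_optimal : LPOptimal E lam ν μ ξ
  ξ_unique : ∀ ξ', LPOptimal E lam ν μ ξ' → ξ' = ξ
  /-- ... which is critically loaded and positive on the edges -/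
  ξ_sum : ∀ j, ∑ i, ξ i j = 1
  ξ_pos : ∀ i j, (i, j) ∈ E → 0 < ξ i j

/-- `ψ ∈ ℝ^𝒢` has row sums `α` and column sums `β`. -/
def HasMarginals (E : Finset (I × J)) (α : I → ℝ) (β : J → ℝ) (ψ : I → J → ℝ) : Prop :=
  ψ ∈ supportedOn E ∧ (∀ i, ∑ j, ψ i j = α i) ∧ ∀ j, ∑ i, ψ i j = β j

open Classical in
/-- The map `Ψ`: the array in `ℝ^𝒢` with row sums `α` and column sums `β`. On a tree it exists
and is unique whenever `∑ α = ∑ β`; in the remaining cases the value is `0` by convention. -/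
noncomputable def Psi (E : Finset (I × J)) (α : I → ℝ) (β : J → ℝ) : I → J → ℝ :=
  if h : ∃ ψ, HasMarginals E α β ψ then h.choose else 0

namespace Network

variable (S : Network I J)

/-- The constant term `h` of the limiting drift; note `z*_{ij} = ξ*_{ij} ν_j`. -/
noncomputable def h (i : I) : ℝ :=
  S.lamHat i - ∑ j ∈ pools S.E i,
    (S.μ i j * S.ξ i j * S.νHat j + S.μHat i j * (S.ξ i j * S.ν j))

/-- The drift `b(x, (uᶜ, uˢ))` of the limiting controlled diffusion. -/
noncomputable def drift (x : I → ℝ) (uc : I → ℝ) (us : J → ℝ) (i : I) : ℝ :=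
  S.h i - ∑ j ∈ pools S.E i,
    S.μ i j * Psi S.E (x - (∑ k, x k)⁺ • uc) (-((∑ k, x k)⁻ • us)) i j

/-- `B₁, B₂` represent the limiting drift as
`b(x, u) = h - B₁ (x - ⟨e, x⟩⁺ uᶜ) + ⟨e, x⟩⁻ B₂ uˢ`, normalized so that the column of `B₂` that
belongs to the pool `j₀` vanishes. -/
def IsDriftPair (j₀ : J) (B₁ : Matrix I I ℝ) (B₂ : Matrix I J ℝ) : Prop :=
  (∀ x : I → ℝ, ∀ uc ∈ stdSimplex ℝ I, ∀ us ∈ stdSimplex ℝ J,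
    S.drift x uc us =
      S.h - B₁ *ᵥ (x - (∑ k, x k)⁺ • uc) + (∑ k, x k)⁻ • (B₂ *ᵥ us)) ∧
  ∀ i, B₂ i j₀ = 0

/-- `B₁ⁿ, B₂ⁿ` represent the linear part of the drift of the `n`-th system:
`∑ j ∈ 𝒥(i), μⁿ i j * Ψ(α, β) i j = (B₁ⁿ α + B₂ⁿ β) i` whenever `∑ α = ∑ β`, normalized so that
the column of `B₂ⁿ` that belongs to the pool `j₀` vanishes. -/
def IsPrelimitDriftPair (n : ℕ) (j₀ : J) (B₁ : Matrix I I ℝ) (B₂ : Matrix I J ℝ) : Prop :=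
  (∀ (α : I → ℝ) (β : J → ℝ), ∑ i, α i = ∑ j, β j →
    ∀ i, ∑ j ∈ pools S.E i, S.μN n i j * Psi S.E α β i j = (B₁ *ᵥ α + B₂ *ᵥ β) i) ∧
  ∀ i, B₂ i j₀ = 0

end Network

end PSN

/-!
Write `e i` for the unit vectors. On an edge `(i, j)` the array with marginals `e i`, `e j` is the
indicator of that edge, so `B₁, B₂` represent the service rates if and only if
`B₁ (e i) + B₂ (e j) = μ i j • e i` on every edge. Such a pair exists because every function on
the edges of a bipartite tree is the sum of a row potential and a column potential.

Multiplying by a row vector `w` gives `(w B₁) i + (w B₂) j = w i * μ i j` on edges, with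
`(w B₂) j₀ = 0`. If `w B₁ = 0`, then `w i` and `(w B₂) j` vanish together on every edge, so
vanishing propagates from `j₀` along the connected graph and `w = 0`; hence `B₁` is invertible. If
`w B₁ = 1`, then `w i` has the sign of `1 + (w B₂) j`, so positivity propagates in the same way from
the value `1` at `j₀`. For that `w` the quantity to be bounded is `∑ j, (1 + (w B₂) j) * us j`.
-/

namespace PSN

theorem exists_potential_of_isTree {V A : Type*} [AddCommGroup A] {G : SimpleGraph V}
    (hG : G.IsTree) {w : V → V → A} (hw : ∀ u v, w v u = -w u v) :
    ∃ f : V → A, ∀ u v, G.Adj u v → f v - f u = w u v := by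
  obtain ⟨r⟩ := hG.connected.nonempty
  choose P hP _ using hG.existsUnique_path r
  let f : V → A := fun v => ((P v).darts.map fun d => w d.fst d.snd).sum
  have sub_eq_of_mem_support : ∀ u v, G.Adj u v → u ∈ (P v).support → f v - f u = w u v := by
    intro u v h hu
    have hconcat : P v = (P u).concat h := hG.isAcyclic.path_concat (hP u) (hP v) h hu
    simp [f, hconcat, SimpleGraph.Walk.darts_concat]
  refine ⟨f, fun u v h => ?_⟩
  by_cases hu : u ∈ (P v).support
  · exact sub_eq_of_mem_support u v h hu
  · have hv : v ∈ (P u).support :=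
      hG.isAcyclic.mem_support_of_ne_mem_support_of_adj_of_isPath (hP u) (hP v) h hu
    rw [← neg_sub, sub_eq_of_mem_support v u h.symm hv, hw u v, neg_neg]

theorem exists_pos_le_dotProduct_of_pos {J : Type*} [Fintype J] {d : J → ℝ} (hd : ∀ j, 0 < d j) :
    ∃ c : ℝ, 0 < c ∧ ∀ u ∈ stdSimplex ℝ J, c ≤ d ⬝ᵥ u := by
  rcases isEmpty_or_nonempty J with _ | _
  · exact ⟨1, one_pos, fun u hu => by simpa using hu.2⟩
  obtain ⟨m, hm⟩ := Finite.exists_min d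
  refine ⟨d m, hd m, fun u hu => ?_⟩
  calc d m = ∑ j, d m * u j := by rw [← Finset.mul_sum, hu.2, mul_one]
    _ ≤ d ⬝ᵥ u := Finset.sum_le_sum fun j _ => mul_le_mul_of_nonneg_right (hm j) (hu.1 j)

section Bipartite

variable {I J : Type*} {E : Finset (I × J)}

theorem bipartiteGraph_adj_inl_inr {i : I} {j : J} :
    (bipartiteGraph E).Adj (Sum.inl i) (Sum.inr j) ↔ (i, j) ∈ E := by
  simp [bipartiteGraph]

theorem exists_add_eq_on_edges {A : Type*} [AddCommGroup A] (hE : (bipartiteGraph E).IsTree)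
    (a : I → J → A) : ∃ (p : I → A) (q : J → A), ∀ i j, (i, j) ∈ E → p i + q j = a i j := by
  obtain ⟨f, hf⟩ := exists_potential_of_isTree hE
    (w := fun u v => match u, v with
      | Sum.inl i, Sum.inr j => a i j
      | Sum.inr j, Sum.inl i => -a i j
      | _, _ => 0)
    (by rintro (i | j) (i' | j') <;> simp)
  refine ⟨fun i => -f (Sum.inl i), fun j => f (Sum.inr j), fun i j hij => ?_⟩
  rw [neg_add_eq_sub, hf _ _ (bipartiteGraph_adj_inl_inr.2 hij)]

theorem exists_eq_const_of_eq_on_edges {A : Type*} (hE : (bipartiteGraph E).Connected)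
    {f : I → A} {g : J → A} (h : ∀ i j, (i, j) ∈ E → f i = g j) :
    ∃ c, (∀ i, f i = c) ∧ ∀ j, g j = c := by
  obtain ⟨r⟩ := hE.nonempty
  have eq_root : ∀ v, Sum.elim f g v = Sum.elim f g r := by
    intro v
    obtain ⟨p⟩ := hE v r
    induction p with
    | nil => rfl
    | cons hadj _ ih =>
      refine Eq.trans ?_ ih
      rcases hadj with ⟨i, j, rfl, rfl, hij⟩ | ⟨i, j, rfl, rfl, hij⟩
      · exact h i j hij
      · exact (h i j hij).symm
  exact ⟨_, fun i => eq_root (Sum.inl i), fun j => eq_root (Sum.inr j)⟩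

end Bipartite

section Marginals

variable {I J : Type*} [Fintype I] [Fintype J] {E : Finset (I × J)}

namespace HasMarginals

variable {α α' : I → ℝ} {β β' : J → ℝ} {ψ ψ' : I → J → ℝ}

theorem zero : HasMarginals E 0 0 (0 : I → J → ℝ) :=
  ⟨fun _ _ _ => rfl, by simp, by simp⟩

theorem add (h : HasMarginals E α β ψ) (h' : HasMarginals E α' β' ψ') :
    HasMarginals E (α + α') (β + β') (ψ + ψ') :=
  ⟨fun i j hij => by simp [h.1 i j hij, h'.1 i j hij],
    fun i => by simp [Finset.sum_add_distrib, h.2.1, h'.2.1],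
    fun j => by simp [Finset.sum_add_distrib, h.2.2, h'.2.2]⟩

theorem smul (c : ℝ) (h : HasMarginals E α β ψ) : HasMarginals E (c • α) (c • β) (c • ψ) :=
  ⟨fun i j hij => by simp [h.1 i j hij],
    fun i => by simp [← Finset.mul_sum, h.2.1],
    fun j => by simp [← Finset.mul_sum, h.2.2]⟩

theorem neg (h : HasMarginals E α β ψ) : HasMarginals E (-α) (-β) (-ψ) := by
  simpa using h.smul (-1)

theorem sub (h : HasMarginals E α β ψ) (h' : HasMarginals E α' β' ψ') :
    HasMarginals E (α - α') (β - β') (ψ - ψ') := by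
  simpa [sub_eq_add_neg] using h.add h'.neg

theorem sum_smul_eq_of_add_eq_on_edges {M : Type*} [AddCommGroup M] [Module ℝ M]
    (hψ : HasMarginals E α β ψ) {a : I → J → M} {p : I → M} {q : J → M}
    (ha : ∀ i j, (i, j) ∈ E → p i + q j = a i j) :
    ∑ i, ∑ j, ψ i j • a i j = ∑ i, α i • p i + ∑ j, β j • q j := by
  have smul_eq : ∀ i j, ψ i j • a i j = ψ i j • p i + ψ i j • q j := by
    intro i j
    by_cases hij : (i, j) ∈ E
    · rw [← ha i j hij, smul_add]
    · simp [hψ.1 i j hij]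
  simp_rw [smul_eq, Finset.sum_add_distrib]
  rw [Finset.sum_comm (f := fun i j => ψ i j • q j)]
  simp_rw [← Finset.sum_smul, hψ.2.1, hψ.2.2]

theorem eq_zero (hE : (bipartiteGraph E).IsTree) (h : HasMarginals E 0 0 ψ) : ψ = 0 := by
  obtain ⟨p, q, hpq⟩ := exists_add_eq_on_edges hE ψ
  have sum_sq : ∑ i, ∑ j, ψ i j * ψ i j = 0 := by
    simpa using h.sum_smul_eq_of_add_eq_on_edges hpq
  ext i j
  have row_sq : ∑ j, ψ i j * ψ i j = 0 :=
    (Finset.sum_eq_zero_iff_of_nonneg fun i _ =>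
      Finset.sum_nonneg fun j _ => mul_self_nonneg (ψ i j)).1 sum_sq i (Finset.mem_univ i)
  exact mul_self_eq_zero.1 <|
    (Finset.sum_eq_zero_iff_of_nonneg fun j _ => mul_self_nonneg (ψ i j)).1 row_sq j
      (Finset.mem_univ j)

theorem unique (hE : (bipartiteGraph E).IsTree) (h : HasMarginals E α β ψ)
    (h' : HasMarginals E α β ψ') : ψ = ψ' :=
  sub_eq_zero.1 (eq_zero hE (by simpa using h.sub h'))

theorem psi_eq (hE : (bipartiteGraph E).IsTree) (h : HasMarginals E α β ψ) :
    Psi E α β = ψ := by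
  have hex : ∃ ψ, HasMarginals E α β ψ := ⟨ψ, h⟩
  rw [Psi, dif_pos hex]
  exact hex.choose_spec.unique hE h

end HasMarginals

/-- The space of pairs of row and column sums of the arrays in `ℝ^𝒢`. -/
def realizableMarginals (E : Finset (I × J)) : Submodule ℝ ((I → ℝ) × (J → ℝ)) where
  carrier := {m | ∃ ψ, HasMarginals E m.1 m.2 ψ}
  zero_mem' := ⟨0, HasMarginals.zero⟩
  add_mem' := fun ⟨ψ, hψ⟩ ⟨φ, hφ⟩ => ⟨ψ + φ, hψ.add hφ⟩
  smul_mem' := fun c _ ⟨ψ, hψ⟩ => ⟨c • ψ, hψ.smul c⟩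

theorem hasMarginals_single [DecidableEq I] [DecidableEq J] {i : I} {j : J} (hij : (i, j) ∈ E) :
    HasMarginals E (Pi.single i 1) (Pi.single j 1) (Pi.single i (Pi.single j 1)) := by
  refine ⟨fun k l hkl => ?_, fun k => ?_, fun l => ?_⟩
  · rcases eq_or_ne k i with rfl | hk
    · have hl : l ≠ j := fun h => hkl (h ▸ hij)
      simp [hl]
    · simp [hk]
  · rcases eq_or_ne k i with rfl | hk
    · simp
    · simp [hk]
  · rw [Finset.sum_eq_single i (fun k _ hk => by simp [hk]) (by simp)]
    simp

theorem mem_realizableMarginals (hE : (bipartiteGraph E).Connected) {α : I → ℝ} {β : J → ℝ}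
    (h : ∑ i, α i = ∑ j, β j) : (α, β) ∈ realizableMarginals E := by
  classical
  let π := (realizableMarginals E).mkQ
  -- An edge identifies its two end points modulo the realizable marginals.
  obtain ⟨c, hrow, hcol⟩ := exists_eq_const_of_eq_on_edges hE
    (f := fun i => π (Pi.single i 1, 0)) (g := fun j => -π (0, Pi.single j 1)) fun i j hij => by
      rw [eq_neg_iff_add_eq_zero, ← map_add, Prod.mk_add_mk, add_zero, zero_add]
      exact (Submodule.Quotient.mk_eq_zero _).2 ⟨_, hasMarginals_single hij⟩
  have decomp : (α, β) = ∑ i, α i • ((Pi.single i 1, 0) : (I → ℝ) × (J → ℝ)) -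
      ∑ j, β j • -((0, Pi.single j 1) : (I → ℝ) × (J → ℝ)) := by
    ext k <;> simp [Prod.fst_sum, Prod.snd_sum, Finset.sum_apply, Pi.single_apply]
  rw [← Submodule.Quotient.mk_eq_zero]
  change π (α, β) = 0
  simp_rw [decomp, map_sub, map_sum, map_smul, map_neg, hrow, hcol, ← Finset.sum_smul, h,
    sub_self]

theorem hasMarginals_psi (hE : (bipartiteGraph E).Connected) {α : I → ℝ} {β : J → ℝ}
    (h : ∑ i, α i = ∑ j, β j) : HasMarginals E α β (Psi E α β) := by
  have hex : ∃ ψ, HasMarginals E α β ψ := mem_realizableMarginals hE h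
  rw [Psi, dif_pos hex]
  exact hex.choose_spec

end Marginals

section ServiceRate

variable {I J : Type*} [Fintype J] [DecidableEq I] [DecidableEq J] {E : Finset (I × J)}

/-- The total rate at which each class is served under the allocation `ψ`. -/
def serviceRate (E : Finset (I × J)) (μ : I → J → ℝ) (ψ : I → J → ℝ) (i : I) : ℝ :=
  ∑ j ∈ pools E i, μ i j * ψ i j

variable {μ : I → J → ℝ}

theorem serviceRate_neg (ψ : I → J → ℝ) : serviceRate E μ (-ψ) = -serviceRate E μ ψ := by
  ext i
  simp [serviceRate]

theorem serviceRate_single {i : I} {j : J} (hij : (i, j) ∈ E) :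
    serviceRate E μ (Pi.single i (Pi.single j 1)) = Pi.single i (μ i j) := by
  ext k
  rcases eq_or_ne k i with rfl | hk
  · simp [serviceRate, pools, Pi.single_apply, hij]
  · simp [serviceRate, hk]

theorem serviceRate_eq_sum_single [Fintype I] {ψ : I → J → ℝ} (hψ : ψ ∈ supportedOn E) :
    serviceRate E μ ψ = ∑ i, ∑ j, ψ i j • Pi.single i (μ i j) := by
  ext k
  have sum_pools : serviceRate E μ ψ k = ∑ j, μ k j * ψ k j := by
    refine Finset.sum_subset (Finset.subset_univ _) fun j _ hj => ?_
    rw [hψ k j (by simpa [pools] using hj), mul_zero]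
  simp [sum_pools, Finset.sum_apply, Pi.single_apply, mul_comm]

end ServiceRate

section RatePair

variable {I J : Type*} [DecidableEq I]

/-- The pair `B₁, B₂` reproduces the service rate of every single edge, and the column of `B₂` that
belongs to the pool `j₀` vanishes. By linearity this describes the matrices of the theorem without
reference to `Ψ`. -/
def IsRatePair (E : Finset (I × J)) (μ : I → J → ℝ) (j₀ : J) (B₁ : Matrix I I ℝ)
    (B₂ : Matrix I J ℝ) : Prop :=
  (∀ i j, (i, j) ∈ E → B₁.col i + B₂.col j = Pi.single i (μ i j)) ∧ ∀ i, B₂ i j₀ = 0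

variable {E : Finset (I × J)} {μ : I → J → ℝ} {j₀ : J} {B₁ : Matrix I I ℝ} {B₂ : Matrix I J ℝ}

theorem exists_isRatePair (hE : (bipartiteGraph E).IsTree) (μ : I → J → ℝ) (j₀ : J) :
    ∃ B₁ B₂, IsRatePair E μ j₀ B₁ B₂ := by
  obtain ⟨p, q, hpq⟩ := exists_add_eq_on_edges hE fun i j => (Pi.single i (μ i j) : I → ℝ)
  refine ⟨.of fun k i => p i k + q j₀ k, .of fun k j => q j k - q j₀ k, fun i j hij => ?_, ?_⟩
  · rw [← hpq i j hij]
    ext k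
    simp
  · simp

namespace IsRatePair

variable [Fintype I]

theorem serviceRate_eq [Fintype J] [DecidableEq J] (hB : IsRatePair E μ j₀ B₁ B₂) {α : I → ℝ}
    {β : J → ℝ} {ψ : I → J → ℝ} (hψ : HasMarginals E α β ψ) :
    serviceRate E μ ψ = B₁ *ᵥ α + B₂ *ᵥ β := by
  rw [serviceRate_eq_sum_single hψ.1, hψ.sum_smul_eq_of_add_eq_on_edges hB.1]
  ext k
  simp [mulVec, dotProduct, Finset.sum_apply, mul_comm]

theorem vecMul_add_vecMul (hB : IsRatePair E μ j₀ B₁ B₂) (w : I → ℝ) {i : I} {j : J}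
    (hij : (i, j) ∈ E) : (w ᵥ* B₁) i + (w ᵥ* B₂) j = w i * μ i j := by
  change w ⬝ᵥ B₁.col i + w ⬝ᵥ B₂.col j = w i * μ i j
  rw [← dotProduct_add, hB.1 i j hij, dotProduct_single]

theorem vecMul_apply_eq_zero (hB : IsRatePair E μ j₀ B₁ B₂) (w : I → ℝ) : (w ᵥ* B₂) j₀ = 0 := by
  simp [vecMul, dotProduct, hB.2]

theorem isUnit_det (hB : IsRatePair E μ j₀ B₁ B₂) (hE : (bipartiteGraph E).Connected)
    (hμ : ∀ i j, (i, j) ∈ E → μ i j ≠ 0) : IsUnit B₁.det := by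
  refine isUnit_iff_ne_zero.2 fun hdet => ?_
  obtain ⟨w, hw, hwB⟩ := exists_vecMul_eq_zero_iff.2 hdet
  have zero_iff : ∀ i j, (i, j) ∈ E → (w i = 0) = ((w ᵥ* B₂) j = 0) := by
    intro i j hij
    have := hB.vecMul_add_vecMul w hij
    rw [hwB, Pi.zero_apply, zero_add] at this
    simp [this, hμ i j hij]
  obtain ⟨c, hrow, hcol⟩ := exists_eq_const_of_eq_on_edges hE zero_iff
  refine hw (funext fun i => ?_)
  rw [Pi.zero_apply, hrow i, ← hcol j₀]
  exact hB.vecMul_apply_eq_zero w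

theorem one_add_vecMul_pos (hB : IsRatePair E μ j₀ B₁ B₂) (hE : (bipartiteGraph E).Connected)
    (hμ : ∀ i j, (i, j) ∈ E → 0 < μ i j) {w : I → ℝ} (hw : w ᵥ* B₁ = 1) (j : J) :
    0 < (1 + w ᵥ* B₂) j := by
  have pos_iff : ∀ i j, (i, j) ∈ E → (0 < w i) = (0 < (1 + w ᵥ* B₂) j) := by
    intro i j hij
    have := hB.vecMul_add_vecMul w hij
    rw [hw, Pi.one_apply] at this
    simp [this, hμ i j hij]
  obtain ⟨c, -, hcol⟩ := exists_eq_const_of_eq_on_edges hE pos_iff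
  rw [hcol j, ← hcol j₀]
  simp [hB.vecMul_apply_eq_zero w]

theorem exists_pos_le_one_add [Fintype J] (hB : IsRatePair E μ j₀ B₁ B₂)
    (hE : (bipartiteGraph E).Connected) (hμ : ∀ i j, (i, j) ∈ E → 0 < μ i j) :
    ∃ c : ℝ, 0 < c ∧ ∀ us ∈ stdSimplex ℝ J,
      c ≤ 1 + (1 : I → ℝ) ⬝ᵥ (B₁⁻¹ *ᵥ (B₂ *ᵥ us)) := by
  have hdet : IsUnit B₁.det := hB.isUnit_det hE fun i j hij => (hμ i j hij).ne'
  have hw : ((1 : I → ℝ) ᵥ* B₁⁻¹) ᵥ* B₁ = 1 := by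
    rw [vecMul_vecMul, nonsing_inv_mul _ hdet, vecMul_one]
  obtain ⟨c, hc, hle⟩ := exists_pos_le_dotProduct_of_pos (hB.one_add_vecMul_pos hE hμ hw)
  refine ⟨c, hc, fun us hus => (hle us hus).trans_eq ?_⟩
  rw [add_dotProduct, one_dotProduct, hus.2, ← dotProduct_mulVec, ← dotProduct_mulVec]

end IsRatePair

end RatePair

section Representation

variable {I J : Type*} [Fintype I] [Fintype J] [DecidableEq I] [DecidableEq J]

/-- `Network.IsDriftPair` for an arbitrary graph, arbitrary service rates `μ` and an arbitrary
constant term `h`. -/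
def IsDriftRepresentation (E : Finset (I × J)) (μ : I → J → ℝ) (h : I → ℝ) (j₀ : J)
    (B₁ : Matrix I I ℝ) (B₂ : Matrix I J ℝ) : Prop :=
  (∀ x : I → ℝ, ∀ uc ∈ stdSimplex ℝ I, ∀ us ∈ stdSimplex ℝ J,
    h - serviceRate E μ (Psi E (x - (∑ k, x k)⁺ • uc) (-((∑ k, x k)⁻ • us))) =
      h - B₁ *ᵥ (x - (∑ k, x k)⁺ • uc) + (∑ k, x k)⁻ • (B₂ *ᵥ us)) ∧
  ∀ i, B₂ i j₀ = 0

/-- `Network.IsPrelimitDriftPair` for an arbitrary graph and arbitrary service rates `μ`. -/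
def IsServiceRepresentation (E : Finset (I × J)) (μ : I → J → ℝ) (j₀ : J)
    (B₁ : Matrix I I ℝ) (B₂ : Matrix I J ℝ) : Prop :=
  (∀ (α : I → ℝ) (β : J → ℝ), ∑ i, α i = ∑ j, β j →
    ∀ i, serviceRate E μ (Psi E α β) i = (B₁ *ᵥ α + B₂ *ᵥ β) i) ∧
  ∀ i, B₂ i j₀ = 0

variable {E : Finset (I × J)} {μ : I → J → ℝ} {h : I → ℝ} {j₀ : J} {B₁ : Matrix I I ℝ}
  {B₂ : Matrix I J ℝ}

theorem isServiceRepresentation_iff (hE : (bipartiteGraph E).IsTree) :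
    IsServiceRepresentation E μ j₀ B₁ B₂ ↔ IsRatePair E μ j₀ B₁ B₂ := by
  refine ⟨fun hB => ⟨fun i j hij => ?_, hB.2⟩, fun hB => ⟨fun α β hαβ i => ?_, hB.2⟩⟩
  · have hrate := funext (hB.1 (Pi.single i 1) (Pi.single j 1) (by simp))
    rw [(hasMarginals_single hij).psi_eq hE, serviceRate_single hij, mulVec_single_one,
      mulVec_single_one] at hrate
    exact hrate.symm
  · rw [hB.serviceRate_eq (hasMarginals_psi hE.connected hαβ)]

theorem isDriftRepresentation_iff (hE : (bipartiteGraph E).IsTree) :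
    IsDriftRepresentation E μ h j₀ B₁ B₂ ↔ IsRatePair E μ j₀ B₁ B₂ := by
  refine ⟨fun hB => ⟨fun i j hij => ?_, hB.2⟩, fun hB => ⟨fun x uc huc us hus => ?_, hB.2⟩⟩
  · -- At `x = -e i` the drift involves `Ψ(-e i, -uˢ)` only, and `uˢ = e j` picks out the edge.
    have hdrift := hB.1 (-Pi.single i 1) _ (single_mem_stdSimplex ℝ i) _
      (single_mem_stdSimplex ℝ j)
    have total : ∑ k, (-Pi.single i 1 : I → ℝ) k = -1 := by simp
    rw [total, posPart_eq_zero.2 (by norm_num), negPart_eq_neg.2 (by norm_num), neg_neg, zero_smul,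
      sub_zero, one_smul, one_smul, (hasMarginals_single hij).neg.psi_eq hE,
      serviceRate_neg, serviceRate_single hij, mulVec_neg, mulVec_single_one, mulVec_single_one,
      sub_neg_eq_add, sub_neg_eq_add, add_assoc] at hdrift
    exact (add_left_cancel hdrift).symm
  · have sum_eq : ∑ i, (x - (∑ k, x k)⁺ • uc) i = ∑ j, (-((∑ k, x k)⁻ • us)) j := by
      simp only [Pi.sub_apply, Pi.smul_apply, Pi.neg_apply, smul_eq_mul, Finset.sum_sub_distrib,
        Finset.sum_neg_distrib, ← Finset.mul_sum, huc.2, hus.2, mul_one]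
      linarith [posPart_sub_negPart (∑ k, x k)]
    rw [hB.serviceRate_eq (hasMarginals_psi hE.connected sum_eq), mulVec_neg, mulVec_smul]
    abel

end Representation

end PSN

theorem lemma2_general {I J : Type*} [Fintype I] [Fintype J] [DecidableEq I] [DecidableEq J]
    {E : Finset (I × J)} (hE : (PSN.bipartiteGraph E).IsTree) {μ : I → J → ℝ}
    (hμ : ∀ i j, (i, j) ∈ E → 0 < μ i j) (h : I → ℝ) (j₀ : J) :
    ((∃ B₁ B₂, PSN.IsDriftRepresentation E μ h j₀ B₁ B₂) ∧
      ∀ B₁ B₂, PSN.IsDriftRepresentation E μ h j₀ B₁ B₂ →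
        IsUnit B₁.det ∧
        ∃ c : ℝ, 0 < c ∧ ∀ us ∈ stdSimplex ℝ J,
          c ≤ 1 + (1 : I → ℝ) ⬝ᵥ (B₁⁻¹ *ᵥ (B₂ *ᵥ us))) ∧
    (∃ B₁ B₂, PSN.IsServiceRepresentation E μ j₀ B₁ B₂) ∧
      ∀ B₁ B₂, PSN.IsServiceRepresentation E μ j₀ B₁ B₂ →
        IsUnit B₁.det ∧
        ∃ c : ℝ, 0 < c ∧ ∀ us ∈ stdSimplex ℝ J,
          c ≤ 1 + (1 : I → ℝ) ⬝ᵥ (B₁⁻¹ *ᵥ (B₂ *ᵥ us)) := by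
  have exists_pair := PSN.exists_isRatePair hE μ j₀
  have bounds : ∀ B₁ B₂, PSN.IsRatePair E μ j₀ B₁ B₂ → IsUnit B₁.det ∧
      ∃ c : ℝ, 0 < c ∧ ∀ us ∈ stdSimplex ℝ J,
        c ≤ 1 + (1 : I → ℝ) ⬝ᵥ (B₁⁻¹ *ᵥ (B₂ *ᵥ us)) := fun _ _ hB =>
    ⟨hB.isUnit_det hE.connected fun i j hij => (hμ i j hij).ne',
      hB.exists_pos_le_one_add hE.connected hμ⟩
  simp_rw [PSN.isDriftRepresentation_iff hE, PSN.isServiceRepresentation_iff hE]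
  exact ⟨⟨exists_pair, bounds⟩, exists_pair, bounds⟩

theorem lemma2 {I J : Type*} [Fintype I] [Fintype J] [DecidableEq I] [DecidableEq J]
    (S : PSN.Network I J) (j₀ : J) :
    ((∃ B₁ B₂, S.IsDriftPair j₀ B₁ B₂) ∧
      ∀ B₁ B₂, S.IsDriftPair j₀ B₁ B₂ →
        IsUnit B₁.det ∧
        ∃ c : ℝ, 0 < c ∧ ∀ us ∈ stdSimplex ℝ J,
          c ≤ 1 + (1 : I → ℝ) ⬝ᵥ (B₁⁻¹ *ᵥ (B₂ *ᵥ us))) ∧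
    ∀ n : ℕ, 1 ≤ n →
      ((∃ B₁ B₂, S.IsPrelimitDriftPair n j₀ B₁ B₂) ∧
        ∀ B₁ B₂, S.IsPrelimitDriftPair n j₀ B₁ B₂ →
          IsUnit B₁.det ∧
          ∃ c : ℝ, 0 < c ∧ ∀ us ∈ stdSimplex ℝ J,
            c ≤ 1 + (1 : I → ℝ) ⬝ᵥ (B₁⁻¹ *ᵥ (B₂ *ᵥ us))) := by
  exact ⟨(lemma2_general S.isTree S.μ_pos S.h j₀).1,
    fun n hn => (lemma2_general S.isTree (S.μN_pos n hn) 0 j₀).2⟩
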